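/- Let $k\ge 2$, let $F$ be a field with $2^k$ elements and let $G=PSL(2,F)=PSL(2,2^k)$. The co-centralizer graph of $G$ is the simple graph whose vertices are the distinct proper subgroups of $G$ of the form $C_G(x)=\{g\in G: gx=xg\}$, $x\in G$, two distinct vertices being adjacent if and only if their cardinalities differ (it is the complement of the centralizer graph, in which distinct vertices are adjacent if and only if their cardinalities are equal). For a finite connected graph $H$ let $D(H)$ be the matrix of distances between vertices, let $Tr(H)$ be the diagonal matrix of the row sums of $D(H)$, and let the distance Laplacian spectrum of $H$ be the multiset of zeros of the characteristic polynomial of $D^L(H)=Tr(H)-D(H)$; $H$ is distance Laplacian integral if this spectrum consists of integers. The co-centralizer graph of $PSL(2,2^k)$ is isomorphic to the complete tripartite graph $K_{2^k+1,\;2^{k-1}(2^k+1),\;2^{k-1}(2^k-1)}$. Its distance Laplacian spectrum consists exactly of the following pairwise distinct eigenvalues: (a) $0$ with multiplicity $1$; (b) $3\cdot 2^{2k-1}+3\cdot 2^{k-1}+1$ with multiplicity $2^{k-1}(2^k+1)-1$; (c) $3\cdot 2^{2k-1}+2^{k-1}+1$ with multiplicity $2^{k-1}(2^k-1)-1$;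 (d) $2^{2k}+2^{k+1}+2$ with multiplicity $2^k$; (e) $2^{2k}+2^k+1$ with multiplicity $2$. In particular, this graph is distance Laplacian integral. -/

import Mathlib

/-- The proper centralizers of `G`: the subgroups `C_G(x)`, `x ∈ G`, that are different from `G`
(each subgroup counted once). -/
abbrev ProperCentralizer (G : Type*) [Group G] : Type _ :=
  {H : Subgroup G // H ≠ ⊤ ∧ ∃ x : G, H = Subgroup.centralizer {x}}

noncomputable instance ProperCentralizer.instFintype (G : Type*) [Group G] [Finite G] :
    Fintype (ProperCentralizer G) := Fintype.ofFinite _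

noncomputable instance ProperCentralizer.instDecidableEq (G : Type*) [Group G] :
    DecidableEq (ProperCentralizer G) := Classical.decEq _

/-- The centralizer graph: two distinct proper centralizers are adjacent iff they have the same
cardinality. -/
def centralizerGraph (G : Type*) [Group G] : SimpleGraph (ProperCentralizer G) where
  Adj H K := H ≠ K ∧ Nat.card H.1 = Nat.card K.1
  symm := ⟨fun _ _ h => ⟨h.1.symm, h.2.symm⟩⟩
  loopless := ⟨fun _ h => h.1 rfl⟩

/-- The co-centralizer graph: the complement of the centralizer graph. -/
def coCentralizerGraph (G : Type*) [Group G] : SimpleGraph (ProperCentralizer G) :=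
  (centralizerGraph G)ᶜ

namespace SimpleGraph

variable {V : Type*} (H : SimpleGraph V)

/-- The distance matrix. -/
noncomputable def distMatrix : Matrix V V ℝ :=
  Matrix.of fun u v => (H.dist u v : ℝ)

/-- The transmission of a vertex. -/
noncomputable def transmission [Fintype V] (v : V) : ℕ :=
  ∑ u, H.dist v u

/-- The distance Laplacian matrix `Tr(H) - D(H)`. -/
noncomputable def distLaplacian [Fintype V] [DecidableEq V] : Matrix V V ℝ :=
  Matrix.diagonal (fun v => (H.transmission v : ℝ)) - H.distMatrix

/-- The distance Laplacian spectrum: the multiset of the zeros of the characteristic polynomial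
of the distance Laplacian matrix, with multiplicity. -/
noncomputable def distLaplacianSpectrum [Fintype V] [DecidableEq V] : Multiset ℝ :=
  H.distLaplacian.charpoly.roots

/-- All distance Laplacian eigenvalues are integers. -/
def IsDistLaplacianIntegral [Fintype V] [DecidableEq V] : Prop :=
  ∀ μ ∈ H.distLaplacianSpectrum, ∃ z : ℤ, μ = z

end SimpleGraph

/-!
In characteristic two `PSL₂(F) = SL₂(F)`. The centralizer of a nonscalar matrix `x` lies in the
algebra `F[x]`, hence is abelian, so the proper centralizers partition the nontrivial elements. Such
a centralizer consists of the `a - b x` of norm `a² - tr(x) a b + b² = 1`, and it has `q + 1 - i`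
elements, where `q` is the order of `F` and `i ∈ {0, 1, 2}` is the number of eigenvalues of `x` in
`F`. Counting the traces, and then the matrices, with a given number of eigenvalues yields the
number of centralizers of each order, and these are the sizes of the parts of the tripartite graph.

For a complete multipartite graph on `N` vertices with parts of sizes `nᵢ`, the distance Laplacian
is a diagonal matrix minus a matrix that only depends on the parts. Its characteristic polynomial is
therefore `∏ᵢ (X - N - nᵢ) ^ (nᵢ - 1)` times the determinant of a matrix indexed by the parts, which
is itself a scalar matrix plus a matrix of rank one.
-/

section Distance

variable {V W : Type*} {H : SimpleGraph V} {K : SimpleGraph W}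

theorem edist_map_le (f : H →g K) (u v : V) : K.edist (f u) (f v) ≤ H.edist u v :=
  le_iInf fun p => (SimpleGraph.edist_le (p.map f)).trans_eq (by rw [SimpleGraph.Walk.length_map])

theorem dist_map_iso (e : H ≃g K) (u v : V) : K.dist (e u) (e v) = H.dist u v := by
  have hle : H.edist u v ≤ K.edist (e u) (e v) := by
    simpa using edist_map_le e.symm.toHom (e u) (e v)
  exact congrArg ENat.toNat ((edist_map_le e.toHom u v).antisymm hle)

variable [Fintype V] [Fintype W] [DecidableEq V] [DecidableEq W]

theorem distLaplacian_reindex_iso (e : H ≃g K) :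
    Matrix.reindex e.toEquiv e.toEquiv H.distLaplacian = K.distLaplacian := by
  have htr (v : V) : H.transmission v = K.transmission (e v) :=
    Fintype.sum_equiv e.toEquiv _ _ fun u => (dist_map_iso e v u).symm
  ext u v
  obtain ⟨u, rfl⟩ := e.surjective u
  obtain ⟨v, rfl⟩ := e.surjective v
  change H.distLaplacian (e.symm (e u)) (e.symm (e v)) = _
  rw [e.symm_apply_apply, e.symm_apply_apply]
  simp [SimpleGraph.distLaplacian, SimpleGraph.distMatrix, Matrix.diagonal_apply, htr,
    dist_map_iso]

theorem distLaplacianSpectrum_eq_of_iso (e : H ≃g K) :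
    H.distLaplacianSpectrum = K.distLaplacianSpectrum := by
  rw [SimpleGraph.distLaplacianSpectrum, SimpleGraph.distLaplacianSpectrum,
    ← distLaplacian_reindex_iso e, Matrix.charpoly_reindex]

end Distance

section Determinant

open Matrix

theorem det_scalar_add_vecMulVec {R n : Type*} [CommRing R] [Fintype n] [DecidableEq n]
    [Nonempty n] (z : R) (u v : n → R) :
    (scalar n z + vecMulVec u v).det = z ^ (Fintype.card n - 1) * (z + u ⬝ᵥ v) := by
  have hneg : scalar n z + vecMulVec u v = scalar n z - vecMulVec (-u) v := by
    rw [neg_vecMulVec, sub_neg_eq_add]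
  rw [hneg, ← eval_charpoly, charpoly_vecMulVec, neg_dotProduct, neg_smul, sub_neg_eq_add]
  simp only [Polynomial.eval_add, Polynomial.eval_smul, Polynomial.eval_pow, Polynomial.eval_X,
    smul_eq_mul]
  rw [mul_add, pow_sub_one_mul Fintype.card_ne_zero, mul_comm]

variable {ι K : Type*} [Field K] [Fintype ι] [DecidableEq ι] {V : ι → Type*}
  [∀ i, Fintype (V i)] [∀ i, DecidableEq (V i)] [∀ i, Nonempty (V i)]

theorem det_diagonal_add_submatrix_fst (C : Matrix ι ι K) {y : ι → K} (hy : ∀ i, y i ≠ 0) :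
    (diagonal (fun v : Σ i, V i => y v.1) + C.submatrix Sigma.fst Sigma.fst).det =
      (∏ i, y i ^ (Fintype.card (V i) - 1)) *
        (diagonal y + C * diagonal fun i => (Fintype.card (V i) : K)).det := by
  let P : Matrix (Σ i, V i) ι K := (1 : Matrix ι ι K).submatrix Sigma.fst id
  let Q : Matrix ι (Σ i, V i) K := C.submatrix id Sigma.fst
  have hpull (M : Matrix ι (Σ i, V i) K) : P * M = M.submatrix Sigma.fst id :=
    one_submatrix_mul Sigma.fst (Equiv.refl ι) M
  have hfactor : diagonal (fun v : Σ i, V i => y v.1) + C.submatrix Sigma.fst Sigma.fst =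
      diagonal (fun v => y v.1) * (1 + P * (diagonal y⁻¹ * Q)) := by
    ext u v
    rw [hpull, Matrix.add_apply, diagonal_mul, Matrix.add_apply, submatrix_apply, submatrix_apply,
      diagonal_mul, mul_add, Pi.inv_apply, mul_inv_cancel_left₀ (hy _)]
    simp [Q, diagonal_apply, one_apply]
  have hquotient : Q * P = C * diagonal fun i => (Fintype.card (V i) : K) := by
    ext i j
    rw [mul_diagonal, Matrix.mul_apply, Fintype.sum_sigma]
    simp [P, Q, one_apply, mul_comm]
  have hdiag : diagonal y * diagonal y⁻¹ = (1 : Matrix ι ι K) := by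
    simp [diagonal_mul_diagonal, hy]
  have hprod : ∏ v : Σ i, V i, y v.1 = (∏ i, y i ^ (Fintype.card (V i) - 1)) * ∏ i, y i := by
    simp only [Fintype.prod_sigma, Finset.prod_const, Finset.card_univ, ← Finset.prod_mul_distrib,
      pow_sub_one_mul Fintype.card_ne_zero]
  calc (diagonal (fun v : Σ i, V i => y v.1) + C.submatrix Sigma.fst Sigma.fst).det
      = (∏ v : Σ i, V i, y v.1) * (1 + diagonal y⁻¹ * (Q * P)).det := by
        rw [hfactor, det_mul, det_diagonal, det_one_add_mul_comm, Matrix.mul_assoc]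
    _ = (∏ i, y i ^ (Fintype.card (V i) - 1)) *
          (diagonal y * (1 + diagonal y⁻¹ * (Q * P))).det := by
        rw [hprod, det_mul, det_diagonal, mul_assoc]
    _ = _ := by
        rw [hquotient, Matrix.mul_add, Matrix.mul_one, ← Matrix.mul_assoc, hdiag, Matrix.one_mul]

end Determinant

section CompleteMultipartite

open Matrix SimpleGraph

variable {ι : Type*} {V : ι → Type*} [Nontrivial ι] [∀ i, Nonempty (V i)]

theorem dist_completeMultipartiteGraph [DecidableEq ι] [∀ i, DecidableEq (V i)] (u v : Σ i, V i) :
    (completeMultipartiteGraph V).dist u v =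
      if u = v then 0 else if u.1 = v.1 then 2 else 1 := by
  split_ifs with huv hpart
  · rw [huv, dist_self]
  · obtain ⟨i, hi⟩ := exists_ne u.1
    obtain ⟨w⟩ := ‹∀ i, Nonempty (V i)› i
    have hedist : (completeMultipartiteGraph V).edist u v = 2 :=
      edist_eq_two_iff.2
        ⟨huv, by simpa using hpart, ⟨i, w⟩, hi.symm, fun h => hi (h.symm.trans hpart.symm)⟩
    rw [SimpleGraph.dist, hedist, ENat.toNat_ofNat]
  · exact dist_eq_one_iff_adj.2 hpart

variable [Fintype ι] [∀ i, Fintype (V i)]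

theorem transmission_completeMultipartiteGraph (u : Σ i, V i) :
    (completeMultipartiteGraph V).transmission u + 2 =
      Fintype.card (Σ i, V i) + Fintype.card (V u.1) := by
  classical
  have hpoint (v : Σ i, V i) : (completeMultipartiteGraph V).dist u v + (if u = v then 2 else 0) =
      1 + if u.1 = v.1 then 1 else 0 := by
    rw [dist_completeMultipartiteGraph]
    split_ifs with huv hpart hpart <;> first | rfl | exact absurd (congrArg Sigma.fst huv) hpart
  have hpart : ∑ v : Σ i, V i, (if u.1 = v.1 then 1 else 0) = Fintype.card (V u.1) := by
    rw [Fintype.sum_sigma]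
    simp [apply_ite Finset.card]
  have hsum := Finset.sum_congr rfl fun v (_ : v ∈ Finset.univ) => hpoint v
  rw [Finset.sum_add_distrib, Finset.sum_add_distrib, hpart] at hsum
  simpa [transmission, Fintype.sum_sigma] using hsum

variable [DecidableEq ι] [∀ i, DecidableEq (V i)]

theorem distLaplacian_completeMultipartiteGraph :
    (completeMultipartiteGraph V).distLaplacian =
      diagonal (fun v => (Fintype.card (Σ i, V i) + Fintype.card (V v.1) : ℝ)) -
        (1 + vecMulVec 1 1 : Matrix ι ι ℝ).submatrix Sigma.fst Sigma.fst := by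
  ext u v
  have htr : ((completeMultipartiteGraph V).transmission u : ℝ) + 2 =
      Fintype.card (Σ i, V i) + Fintype.card (V u.1) :=
    mod_cast transmission_completeMultipartiteGraph u
  rw [distLaplacian, distMatrix, Matrix.sub_apply, Matrix.sub_apply, diagonal_apply, diagonal_apply,
    ← htr, of_apply, dist_completeMultipartiteGraph, submatrix_apply, Matrix.add_apply, one_apply,
    vecMulVec_apply]
  simp only [Pi.one_apply]
  split_ifs with huv hpart hpart
  · push_cast; ring
  · exact absurd (congrArg Sigma.fst huv) hpart
  · push_cast; ring
  · push_cast; ring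

open Polynomial in
theorem charpoly_distLaplacian_completeMultipartiteGraph :
    (completeMultipartiteGraph V).distLaplacian.charpoly =
      X * (X - C (Fintype.card (Σ i, V i) : ℝ)) ^ (Fintype.card ι - 1) *
        ∏ i, (X - C (Fintype.card (Σ i, V i) + Fintype.card (V i) : ℝ)) ^
          (Fintype.card (V i) - 1) := by
  set N : ℝ := ((Fintype.card (Σ i, V i) : ℕ) : ℝ) with hN
  let n (i : ι) : ℝ := Fintype.card (V i)
  have hsum : ∑ i, n i = N := by simp [n, hN]
  -- Away from the finitely many `N + n i` the diagonal part is invertible, so that the determinant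
  -- collapses to the quotient matrix indexed by the parts.
  refine eq_of_infinite_eval_eq _ _ (((Set.finite_range fun i => N + n i).infinite_compl).mono ?_)
  intro x hx
  have hy (i : ι) : x - (N + n i) ≠ 0 := fun h => hx ⟨i, (sub_eq_zero.1 h).symm⟩
  have hshift : scalar _ x - (completeMultipartiteGraph V).distLaplacian =
      diagonal (fun v : Σ i, V i => x - (N + n v.1)) +
        (1 + vecMulVec 1 1 : Matrix ι ι ℝ).submatrix Sigma.fst Sigma.fst := by
    rw [distLaplacian_completeMultipartiteGraph, scalar_apply, ← sub_add, diagonal_sub]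
  have hquotient : diagonal (fun i => x - (N + n i)) + (1 + vecMulVec 1 1) * diagonal n =
      scalar ι (x - N) + vecMulVec 1 n := by
    have hones : vecMulVec 1 1 * diagonal n = vecMulVec 1 n := by
      ext i j
      simp [vecMulVec_apply]
    rw [Matrix.add_mul, Matrix.one_mul, hones, ← add_assoc, diagonal_add, scalar_apply]
    simp only [sub_add_eq_sub_sub, sub_add_cancel]
  have hdet : (scalar ι (x - N) + vecMulVec 1 n).det = (x - N) ^ (Fintype.card ι - 1) * x := by
    rw [det_scalar_add_vecMulVec, one_dotProduct, hsum, sub_add_cancel]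
  simp only [Set.mem_ofPred_eq]
  rw [eval_charpoly, hshift, det_diagonal_add_submatrix_fst _ hy, hquotient, hdet]
  simp only [eval_mul, eval_pow, eval_sub, eval_X, eval_C, eval_prod, n]
  ring

theorem distLaplacianSpectrum_completeMultipartiteGraph :
    (completeMultipartiteGraph V).distLaplacianSpectrum =
      {0} + Multiset.replicate (Fintype.card ι - 1) (Fintype.card (Σ i, V i) : ℝ) +
        ∑ i, Multiset.replicate (Fintype.card (V i) - 1)
          (Fintype.card (Σ i, V i) + Fintype.card (V i) : ℝ) := by
  rw [distLaplacianSpectrum, charpoly_distLaplacian_completeMultipartiteGraph,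
    ← Polynomial.roots_multiset_prod_X_sub_C (_ + _ + _), Multiset.map_add, Multiset.map_add,
    ← Multiset.coe_mapAddMonoidHom, map_sum]
  simp only [Multiset.coe_mapAddMonoidHom, Multiset.map_singleton, Multiset.map_replicate,
    Multiset.prod_add, Multiset.prod_sum, Multiset.prod_singleton, Multiset.prod_replicate,
    map_zero, sub_zero]

theorem isDistLaplacianIntegral_completeMultipartiteGraph :
    (completeMultipartiteGraph V).IsDistLaplacianIntegral := by
  intro μ hμ
  simp only [distLaplacianSpectrum_completeMultipartiteGraph, Multiset.mem_add,
    Multiset.mem_singleton, Multiset.mem_replicate, Multiset.mem_sum, Finset.mem_univ,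
    true_and] at hμ
  rcases hμ with (rfl | ⟨-, rfl⟩) | ⟨i, -, rfl⟩
  · exact ⟨0, by simp⟩
  · exact ⟨Fintype.card (Σ i, V i), by simp⟩
  · exact ⟨Fintype.card (Σ i, V i) + Fintype.card (V i), by simp⟩

end CompleteMultipartite

section CoCentralizerGraph

variable {G G' : Type*} [Group G] [Group G']

theorem coCentralizerGraph_eq_comap :
    coCentralizerGraph G = (⊤ : SimpleGraph ℕ).comap fun H => Nat.card H.1 := by
  ext H K
  have hne (h : Nat.card H.1 ≠ Nat.card K.1) : H ≠ K := ne_of_apply_ne (fun L => Nat.card L.1) h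
  simp only [coCentralizerGraph, centralizerGraph, SimpleGraph.compl_adj, SimpleGraph.comap_adj,
    SimpleGraph.top_adj]
  tauto

theorem map_centralizer_singleton (e : G ≃* G') (x : G) :
    (Subgroup.centralizer {x}).map e.toMonoidHom = Subgroup.centralizer {e x} := by
  ext y
  obtain ⟨y, rfl⟩ := e.surjective y
  simp [Subgroup.mem_centralizer_singleton_iff, ← map_mul]

theorem nonempty_coCentralizerGraph_iso (e : G ≃* G') :
    Nonempty (coCentralizerGraph G ≃g coCentralizerGraph G') := by
  have hproper (H : Subgroup G) : (H ≠ ⊤ ∧ ∃ x, H = Subgroup.centralizer {x}) ↔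
      e.mapSubgroup H ≠ ⊤ ∧ ∃ y, e.mapSubgroup H = Subgroup.centralizer {y} := by
    rw [Ne, Ne, map_eq_top_iff, e.surjective.exists]
    simp only [← map_centralizer_singleton]
    exact and_congr_right' (exists_congr fun x => e.mapSubgroup.injective.eq_iff.symm)
  rw [coCentralizerGraph_eq_comap, coCentralizerGraph_eq_comap]
  refine ⟨⟨e.mapSubgroup.toEquiv.subtypeEquiv hproper, fun {H K} => ?_⟩⟩
  have hcard (L : Subgroup G) : Nat.card (e.mapSubgroup L) = Nat.card L :=
    (Nat.card_congr (e.subgroupMap L).toEquiv).symm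
  exact not_congr (by simp only [Equiv.subtypeEquiv_apply, OrderIso.coe_toEquiv, hcard])

end CoCentralizerGraph

theorem nonempty_comap_top_iso_completeMultipartiteGraph {V β ι : Type*} [Finite V] {f : V → β}
    {c : ι → β} (hc : Function.Injective c) (hf : ∀ v, ∃ i, c i = f v) {n : ι → ℕ}
    (hn : ∀ i, Nat.card {v // f v = c i} = n i) :
    Nonempty ((⊤ : SimpleGraph β).comap f ≃g
      SimpleGraph.completeMultipartiteGraph fun i => Fin (n i)) := by
  choose g hg using hf
  have hfiber (i : ι) : Nat.card {v // g v = i} = n i := by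
    simp only [← hn, ← hg, hc.eq_iff]
  let e : V ≃ Σ i, Fin (n i) := (Equiv.sigmaFiberEquiv g).symm.trans
    (Equiv.sigmaCongrRight fun i => Finite.equivFinOfCardEq (hfiber i))
  refine ⟨⟨e, fun {u v} => ?_⟩⟩
  change g u ≠ g v ↔ f u ≠ f v
  rw [← hg, ← hg, hc.ne_iff]

section CommutativeTransitive

/-- A group is commutative transitive if commuting is a transitive relation on its nontrivial
elements, equivalently if the centralizers of the nontrivial elements are abelian. The centralizers
of nontrivial elements then meet pairwise trivially or coincide. -/
def IsCommutativeTransitive (G : Type*) [Group G] : Prop :=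
  ∀ ⦃x y z : G⦄, y ≠ 1 → Commute x y → Commute y z → Commute x z

variable {G : Type*} [Group G]

theorem IsCommutativeTransitive.centralizer_eq_of_commute (hG : IsCommutativeTransitive G)
    {x y : G} (hx : x ≠ 1) (hy : y ≠ 1) (hxy : Commute x y) :
    Subgroup.centralizer {x} = Subgroup.centralizer {y} := by
  ext z
  rw [Subgroup.mem_centralizer_singleton_iff, Subgroup.mem_centralizer_singleton_iff]
  exact ⟨fun hz => hG hx hz hxy, fun hz => hG hy hz hxy.symm⟩

theorem IsCommutativeTransitive.setOf_centralizer_eq (hG : IsCommutativeTransitive G)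
    (H : ProperCentralizer G) :
    {x : G | x ≠ 1 ∧ Subgroup.centralizer {x} = H.1} = (H.1 : Set G) \ {1} := by
  obtain ⟨_, htop, y, rfl⟩ := H
  have hy : y ≠ 1 := by
    rintro rfl
    exact htop (Subgroup.centralizer_eq_top_iff_subset.2 (by simp))
  ext x
  constructor
  · rintro ⟨hx, hxy⟩
    exact ⟨hxy ▸ Subgroup.mem_centralizer_singleton_iff.2 rfl, hx⟩
  · rintro ⟨hxy, hx⟩
    exact ⟨hx, hG.centralizer_eq_of_commute hx hy (Subgroup.mem_centralizer_singleton_iff.1 hxy)⟩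

theorem IsCommutativeTransitive.card_properCentralizer_mul [Finite G]
    (hG : IsCommutativeTransitive G) (hcenter : Subgroup.center G = ⊥) (m : ℕ) :
    Nat.card {H : ProperCentralizer G // Nat.card H.1 = m} * (m - 1) =
      Nat.card {x : G // x ≠ 1 ∧ Nat.card (Subgroup.centralizer {x}) = m} := by
  have hproper {x : G} (hx : x ≠ 1) : Subgroup.centralizer {x} ≠ ⊤ := fun htop => hx <| by
    simpa [hcenter] using Subgroup.centralizer_eq_top_iff_subset.1 htop
  let φ (x : {x : G // x ≠ 1 ∧ Nat.card (Subgroup.centralizer {x}) = m}) :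
      {H : ProperCentralizer G // Nat.card H.1 = m} :=
    ⟨⟨Subgroup.centralizer {x.1}, hproper x.2.1, x.1, rfl⟩, x.2.2⟩
  have hfiber (H : {H : ProperCentralizer G // Nat.card H.1 = m}) :
      Nat.card {x // φ x = H} = m - 1 := by
    have e : {x // φ x = H} ≃ {x : G | x ≠ 1 ∧ Subgroup.centralizer {x} = H.1.1} :=
      { toFun x := ⟨x.1.1, x.1.2.1, congrArg (fun K => K.1.1) x.2⟩
        invFun x := ⟨⟨x.1, x.2.1, by rw [x.2.2, H.2]⟩, Subtype.ext (Subtype.ext x.2.2)⟩ }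
    rw [Nat.card_congr e, hG.setOf_centralizer_eq, Nat.card_coe_set_eq,
      Set.ncard_sdiff_singleton_of_mem H.1.1.one_mem, ← Nat.card_coe_set_eq]
    exact congrArg (· - 1) H.2
  have := Fintype.ofFinite {H : ProperCentralizer G // Nat.card H.1 = m}
  rw [← Nat.card_congr (Equiv.sigmaFiberEquiv φ), Nat.card_sigma]
  simp only [hfiber, Finset.sum_const, Finset.card_univ, smul_eq_mul, Nat.card_eq_fintype_card]

end CommutativeTransitive

section Commutant

open Matrix

variable {F : Type*} [Field F]

theorem exists_eq_smul_one_sub_smul_of_commute {A B : Matrix (Fin 2) (Fin 2) F}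
    (hA : ∀ r, A ≠ scalar (Fin 2) r) (hAB : Commute A B) :
    ∃ p : F × F, B = p.1 • 1 - p.2 • A := by
  have hcomm (i j : Fin 2) : A i 0 * B 0 j + A i 1 * B 1 j = B i 0 * A 0 j + B i 1 * A 1 j := by
    simpa [Matrix.mul_apply] using congrFun₂ hAB.eq i j
  have hentry : A 0 1 ≠ 0 ∨ A 1 0 ≠ 0 ∨ A 0 0 - A 1 1 ≠ 0 := by
    by_contra! h
    refine hA (A 0 0) ?_
    ext i j
    fin_cases i <;> fin_cases j <;> simp [h, sub_eq_zero.1 h.2.2]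
  suffices ∃ s, B 0 1 = -s * A 0 1 ∧ B 1 0 = -s * A 1 0 ∧
      B 0 0 - B 1 1 = -s * (A 0 0 - A 1 1) by
    obtain ⟨s, h01, h10, hdiag⟩ := this
    refine ⟨(B 0 0 + s * A 0 0, s), ?_⟩
    ext i j
    fin_cases i <;> fin_cases j <;> simp [h01, h10]
    linear_combination -hdiag
  rcases hentry with h | h | h
  · refine ⟨-B 0 1 / A 0 1, ?_, ?_, ?_⟩ <;> field_simp
    · linear_combination hcomm 0 0
    · linear_combination -hcomm 0 1
  · refine ⟨-B 1 0 / A 1 0, ?_, ?_, ?_⟩ <;> field_simp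
    · linear_combination -hcomm 0 0
    · linear_combination hcomm 1 0
  · refine ⟨-(B 0 0 - B 1 1) / (A 0 0 - A 1 1), ?_, ?_, ?_⟩ <;> field_simp
    · linear_combination hcomm 0 1
    · linear_combination -hcomm 1 0

theorem commute_smul_one_sub_smul {A B : Matrix (Fin 2) (Fin 2) F} (p : F × F)
    (hAB : Commute A B) : Commute (p.1 • 1 - p.2 • A) B :=
  ((Commute.one_left B).smul_left p.1).sub_left (hAB.smul_left p.2)

theorem smul_one_sub_smul_injective {A : Matrix (Fin 2) (Fin 2) F}
    (hA : ∀ r, A ≠ scalar (Fin 2) r) : Function.Injective fun p : F × F => p.1 • 1 - p.2 • A := by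
  intro p q hpq
  have hsmul : (p.2 - q.2) • A = (p.1 - q.1) • 1 := by
    rw [sub_smul, sub_smul, sub_eq_sub_iff_add_eq_add, add_comm]
    exact (sub_eq_sub_iff_add_eq_add.1 hpq).symm
  have hsnd : p.2 = q.2 := by
    by_contra h
    refine hA ((p.2 - q.2)⁻¹ * (p.1 - q.1)) ?_
    rw [scalar_apply, ← smul_one_eq_diagonal, mul_smul, ← hsmul, inv_smul_smul₀ (sub_ne_zero.2 h)]
  have hfst : p.1 = q.1 := by
    simpa [hsnd, sub_eq_zero] using hsmul.symm
  exact Prod.ext hfst hsnd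

end Commutant

section SpecialLinearGroup

open Matrix Subgroup
open scoped MatrixGroups

theorem center_specialLinearGroup_eq_bot {R : Type*} [CommRing R] [NoZeroDivisors R] [CharP R 2] :
    center SL(2, R) = ⊥ := by
  refine (eq_bot_iff_forall _).2 fun x hx => ?_
  obtain ⟨r, hr, hx⟩ := Matrix.SpecialLinearGroup.mem_center_iff.1 hx
  have hr : r = 1 := CharTwo.sq_injective (by simpa using hr)
  exact Subtype.ext (by rw [← hx, hr, map_one, Matrix.SpecialLinearGroup.coe_one])

variable {F : Type*} [Field F]

theorem coe_ne_scalar_of_notMem_center {x : SL(2, F)} (hx : x ∉ center SL(2, F)) (r : F) :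
    (x : Matrix (Fin 2) (Fin 2) F) ≠ scalar (Fin 2) r := fun h =>
  hx <| mem_center_iff.2 fun y => Subtype.ext <|
    (h ▸ scalar_commute r (Commute.all r) y.1 : Commute x.1 y.1).symm

theorem exists_coe_eq_of_commute {x y : SL(2, F)} (hx : x ∉ center SL(2, F))
    (hxy : Commute x y) : ∃ p : F × F, (y : Matrix (Fin 2) (Fin 2) F) = p.1 • 1 - p.2 • x.1 :=
  exists_eq_smul_one_sub_smul_of_commute (coe_ne_scalar_of_notMem_center hx)
    (congrArg Subtype.val hxy.eq)

theorem isCommutativeTransitive_specialLinearGroup (h : center SL(2, F) = ⊥) :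
    IsCommutativeTransitive SL(2, F) := by
  intro x y z hy hxy hyz
  have hy : y ∉ center SL(2, F) := by rwa [h, mem_bot]
  obtain ⟨p, hp⟩ := exists_coe_eq_of_commute hy hxy.symm
  obtain ⟨q, hq⟩ := exists_coe_eq_of_commute hy hyz
  refine Commute.of_map Matrix.SpecialLinearGroup.coeMonoidHom_injective ?_
  rw [Matrix.SpecialLinearGroup.coeMonoidHom_apply, Matrix.SpecialLinearGroup.coeMonoidHom_apply,
    hp, hq]
  exact (commute_smul_one_sub_smul q (commute_smul_one_sub_smul p (Commute.refl y.1)).symm).symm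

theorem card_centralizer_specialLinearGroup {x : SL(2, F)} (hx : x ∉ center SL(2, F)) :
    Nat.card (centralizer {x}) =
      Nat.card {p : F × F // p.1 ^ 2 - x.1.trace * p.1 * p.2 + p.2 ^ 2 = 1} := by
  have hdet (p : F × F) :
      (p.1 • 1 - p.2 • x.1).det = p.1 ^ 2 - x.1.trace * p.1 * p.2 + p.2 ^ 2 := by
    have hx := x.det_coe
    rw [det_fin_two] at hx ⊢
    simp only [trace_fin_two, Matrix.sub_apply, Matrix.smul_apply, one_apply_eq, one_apply_ne,
      ne_eq, smul_eq_mul, mul_one, mul_zero, zero_sub, zero_ne_one, one_ne_zero,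
      not_false_eq_true]
    linear_combination p.2 ^ 2 * hx
  symm
  let φ (p : {p : F × F // p.1 ^ 2 - x.1.trace * p.1 * p.2 + p.2 ^ 2 = 1}) : centralizer {x} :=
    ⟨⟨p.1.1 • 1 - p.1.2 • x.1, (hdet p.1).trans p.2⟩, mem_centralizer_singleton_iff.2
      (Subtype.ext (commute_smul_one_sub_smul p.1 (Commute.refl x.1)))⟩
  refine Nat.card_congr (Equiv.ofBijective φ ⟨fun p q hpq => ?_, fun y => ?_⟩)
  · exact Subtype.ext <| smul_one_sub_smul_injective (coe_ne_scalar_of_notMem_center hx) <|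
      congrArg (fun y : centralizer {x} => y.1.1) hpq
  · obtain ⟨p, hp⟩ := exists_coe_eq_of_commute hx
      (mem_centralizer_singleton_iff.1 y.2).symm
    exact ⟨⟨p, by rw [← hdet, ← hp, y.1.det_coe]⟩, Subtype.ext (Subtype.ext hp.symm)⟩

end SpecialLinearGroup

section Eigenvalues

variable {F : Type*} [Field F]

/-- The number of elements of `F` that are eigenvalues of the elements of `SL₂(F)` of trace `t`,
that is, the number of roots in `F` of their characteristic polynomial `X ^ 2 - t * X + 1`. -/
noncomputable def numEigenvalues (t : F) : ℕ := Nat.card {r : F // r ^ 2 - t * r + 1 = 0}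

open Classical in
theorem numEigenvalues_eq_of_root {t r : F} (hr : r ^ 2 - t * r + 1 = 0) :
    numEigenvalues t = if r = t - r then 1 else 2 := by
  have hroots : {s : F | s ^ 2 - t * s + 1 = 0} = {r, t - r} := by
    ext s
    have hfactor : s ^ 2 - t * s + 1 = (s - r) * (s - (t - r)) := by linear_combination hr
    simp only [Set.mem_ofPred_eq, hfactor, mul_eq_zero, sub_eq_zero, Set.mem_insert_iff,
      Set.mem_singleton_iff]
  rw [numEigenvalues, ← Set.coe_ofPred, Nat.card_coe_set_eq, hroots]
  split_ifs with h
  · rw [← h, Set.pair_eq_singleton, Set.ncard_singleton]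
  · rw [Set.ncard_pair h]

theorem numEigenvalues_eq_zero_or_exists_root (t : F) :
    numEigenvalues t = 0 ∨ ∃ r, r ^ 2 - t * r + 1 = 0 := by
  rw [numEigenvalues, or_iff_not_imp_right]
  intro h
  have : IsEmpty {r : F // r ^ 2 - t * r + 1 = 0} := ⟨fun r => h ⟨r, r.2⟩⟩
  exact Nat.card_of_isEmpty

theorem numEigenvalues_le_two (t : F) : numEigenvalues t ≤ 2 := by
  classical
  rcases numEigenvalues_eq_zero_or_exists_root t with h | ⟨r, hr⟩
  · omega
  · rw [numEigenvalues_eq_of_root hr]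
    split_ifs <;> norm_num

theorem numEigenvalues_eq_one_iff [CharP F 2] {t : F} : numEigenvalues t = 1 ↔ t = 0 := by
  classical
  constructor
  · intro h
    obtain ⟨r, hr⟩ := (numEigenvalues_eq_zero_or_exists_root t).resolve_left (by omega)
    rw [numEigenvalues_eq_of_root hr] at h
    have hfix : r = t - r := by
      by_contra hne
      simp [hne] at h
    rw [← sub_add_cancel t r, ← hfix, CharTwo.add_self_eq_zero]
  · rintro rfl
    have hone : (1 : F) ^ 2 - 0 * 1 + 1 = 0 := by
      rw [one_pow, zero_mul, sub_zero, CharTwo.add_self_eq_zero]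
    rw [numEigenvalues_eq_of_root hone, if_pos]
    rw [zero_sub, CharTwo.neg_eq]

section Count

variable [Fintype F]

theorem sum_numEigenvalues : ∑ t : F, numEigenvalues t + 1 = Fintype.card F := by
  let φ (u : Fˣ) : Σ t : F, {r : F // r ^ 2 - t * r + 1 = 0} :=
    ⟨u + ↑u⁻¹, u, by linear_combination -u.mul_inv⟩
  have hφ : Function.Bijective φ := by
    refine ⟨fun u v huv => Units.ext (congrArg (fun p => p.2.1) huv), fun ⟨t, r, hr⟩ => ?_⟩
    have hr0 : r ≠ 0 := by
      rintro rfl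
      simp at hr
    obtain rfl : t = r + r⁻¹ := by
      field_simp
      linear_combination -hr
    exact ⟨Units.mk0 r hr0, rfl⟩
  have hsum : ∑ t : F, numEigenvalues t = Nat.card Fˣ := by
    rw [Nat.card_eq_of_bijective φ hφ, Nat.card_sigma]
    rfl
  rw [hsum, ← Nat.card_eq_card_units_add_one, Nat.card_eq_fintype_card]

theorem card_fiber_numEigenvalues [CharP F 2] :
    Nat.card {t : F // numEigenvalues t = 1} = 1 ∧
    2 * Nat.card {t : F // numEigenvalues t = 2} + 2 = Fintype.card F ∧
    2 * Nat.card {t : F // numEigenvalues t = 0} = Fintype.card F := by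
  have hone : Nat.card {t : F // numEigenvalues t = 1} = 1 := by
    simp only [numEigenvalues_eq_one_iff, Nat.card_unique]
  have hmem (t : F) : numEigenvalues t ∈ Finset.range 3 :=
    Finset.mem_range_succ_iff.2 (numEigenvalues_le_two t)
  have hcard (i : ℕ) : Nat.card {t : F // numEigenvalues t = i} =
      (Finset.univ.filter fun t : F => numEigenvalues t = i).card := by
    rw [Nat.card_eq_fintype_card, Fintype.card_subtype]
  have htotal :
      Fintype.card F = ∑ i ∈ Finset.range 3, Nat.card {t : F // numEigenvalues t = i} := by
    simp only [hcard]
    exact Finset.card_eq_sum_card_fiberwise fun t _ => hmem t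
  have hsum : ∑ i ∈ Finset.range 3, Nat.card {t : F // numEigenvalues t = i} * i + 1 =
      Fintype.card F := by
    rw [← sum_numEigenvalues, ← Finset.sum_fiberwise_of_maps_to' (fun t _ => hmem t) fun i => i]
    simp only [hcard, Finset.sum_const, smul_eq_mul]
  simp only [Finset.sum_range_succ, Finset.sum_range_zero] at htotal hsum
  omega

theorem card_mul_eq [DecidableEq F] (s : F) :
    Nat.card {p : F × F // p.1 * p.2 = s} + 1 =
      Fintype.card F + if s = 0 then Fintype.card F else 0 := by
  have hfiber (b : F) : Nat.card {c // b * c = s} + (if b = 0 then 1 else 0) =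
      1 + if b = 0 then if s = 0 then Fintype.card F else 0 else 0 := by
    split_ifs with hb hs
    · simp [hb, hs, add_comm]
    · simp [hb, Ne.symm hs]
    · exact Nat.card_eq_one_iff_exists.2 ⟨⟨b⁻¹ * s, mul_inv_cancel_left₀ hb s⟩,
        fun c => Subtype.ext ((eq_inv_mul_iff_mul_eq₀ hb).2 c.2)⟩
  have hsum := Finset.sum_congr rfl fun b (_ : b ∈ Finset.univ) => hfiber b
  rw [Finset.sum_add_distrib, Finset.sum_add_distrib, Fintype.sum_ite_eq', Fintype.sum_ite_eq',
    ← Nat.card_sigma, ← Finset.card_eq_sum_ones, Finset.card_univ] at hsum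
  rw [Nat.card_congr (Equiv.subtypeProdEquivSigmaSubtype fun b c => b * c = s), hsum]

theorem card_norm_eq_one [CharP F 2] (t : F) :
    Nat.card {p : F × F // p.1 ^ 2 - t * p.1 * p.2 + p.2 ^ 2 = 1} + numEigenvalues t =
      Fintype.card F + 1 := by
  classical
  -- The form is homogeneous and squaring is bijective on `F`, so each ratio `p.1 / p.2` at which
  -- the form does not vanish is attained exactly once; `none` stands for the ratio `1 / 0`.
  have hscale (r : {r : F // r ^ 2 - t * r + 1 ≠ 0}) :
      ∃ b : F, b ^ 2 * (r.1 ^ 2 - t * r + 1) = 1 := by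
    obtain ⟨b, hb⟩ := FiniteField.isSquare_of_char_two (ringChar.eq F 2) (r.1 ^ 2 - t * r + 1)⁻¹
    exact ⟨b, by rw [sq, ← hb, inv_mul_cancel₀ r.2]⟩
  choose b hb using hscale
  have hb0 (r) : b r ≠ 0 := fun h => by simpa [h] using hb r
  let φ : Option {r : F // r ^ 2 - t * r + 1 ≠ 0} →
      {p : F × F // p.1 ^ 2 - t * p.1 * p.2 + p.2 ^ 2 = 1}
    | none => ⟨(1, 0), by ring⟩
    | some r => ⟨(r * b r, b r), by linear_combination hb r⟩
  have hφ : Function.Bijective φ := by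
    constructor
    · rintro (_ | r) (_ | s) h <;>
        simp only [φ, Subtype.mk.injEq, Prod.mk.injEq, Option.some.injEq, reduceCtorEq] at h ⊢
      · exact hb0 s h.2.symm
      · exact hb0 r h.2
      · rw [h.2] at h
        exact Subtype.ext (mul_right_cancel₀ (hb0 s) h.1)
    · rintro ⟨⟨x, y⟩, hxy⟩
      rcases eq_or_ne y 0 with rfl | hy
      · have hx : x = 1 := CharTwo.sq_injective (by simpa using hxy)
        exact ⟨none, by simp [φ, hx]⟩
      · have hnorm : y ^ 2 * ((x / y) ^ 2 - t * (x / y) + 1) = 1 := by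
          field_simp
          linear_combination hxy
        let r : {r : F // r ^ 2 - t * r + 1 ≠ 0} := ⟨x / y, right_ne_zero_of_mul_eq_one hnorm⟩
        have hbr : b r = y :=
          CharTwo.sq_injective (mul_right_cancel₀ r.2 ((hb r).trans hnorm.symm))
        exact ⟨some r, by simp [φ, hbr, r, hy]⟩
  have hcompl := Nat.card_congr (Equiv.sumCompl fun r : F => r ^ 2 - t * r + 1 = 0)
  rw [Nat.card_sum, Nat.card_eq_fintype_card (α := F)] at hcompl
  rw [← Nat.card_eq_of_bijective φ hφ, Finite.card_option, ← hcompl, numEigenvalues]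
  ring

theorem card_trace_eq (t : F) :
    Nat.card {x : Matrix.SpecialLinearGroup (Fin 2) F // x.1.trace = t} + Fintype.card F =
      Fintype.card F ^ 2 + Fintype.card F * numEigenvalues t := by
  classical
  let e : {x : Matrix.SpecialLinearGroup (Fin 2) F // x.1.trace = t} ≃
      Σ a, {p : F × F // p.1 * p.2 = -(a ^ 2 - t * a + 1)} :=
    { toFun x := ⟨x.1 0 0, (x.1 0 1, x.1 1 0), by
        have hdet := x.1.det_coe
        have htrace := x.2
        rw [Matrix.det_fin_two] at hdet
        rw [Matrix.trace_fin_two] at htrace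
        linear_combination -hdet + x.1 0 0 * htrace⟩
      invFun p := ⟨⟨!![p.1, p.2.1.1; p.2.1.2, t - p.1], by
        rw [Matrix.det_fin_two_of, p.2.2]; ring⟩, by simp [Matrix.trace_fin_two]⟩
      left_inv x := by
        ext i j
        have htrace := x.2
        rw [Matrix.trace_fin_two] at htrace
        fin_cases i <;> fin_cases j <;> simp [← htrace]
      right_inv p := rfl }
  have hsum := Finset.sum_congr rfl fun a (_ : a ∈ Finset.univ) =>
    card_mul_eq (-(a ^ 2 - t * a + 1))
  have hroots : ∑ a, (if -(a ^ 2 - t * a + 1) = 0 then Fintype.card F else 0) =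
      Fintype.card F * numEigenvalues t := by
    rw [numEigenvalues, Nat.card_eq_fintype_card, Fintype.card_subtype, mul_comm]
    simp only [neg_eq_zero, Finset.sum_ite, Finset.sum_const, smul_eq_mul, mul_zero, add_zero]
  rw [Finset.sum_add_distrib, Finset.sum_add_distrib, hroots, ← Nat.card_sigma,
    Finset.sum_const, Finset.sum_const, Finset.card_univ, smul_eq_mul, smul_eq_mul, mul_one] at hsum
  rw [Nat.card_congr e, hsum, sq]

end Count
end Eigenvalues

section CharTwo

open Matrix Subgroup
open scoped MatrixGroups

variable {F : Type*} [Field F] [Fintype F]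

theorem card_numEigenvalues_trace_eq (i : ℕ) :
    Nat.card {x : SL(2, F) // numEigenvalues x.1.trace = i} +
        Nat.card {t : F // numEigenvalues t = i} * Fintype.card F =
      Nat.card {t : F // numEigenvalues t = i} * (Fintype.card F ^ 2 + Fintype.card F * i) := by
  classical
  have hsum := Finset.sum_congr rfl fun (t : {t : F // numEigenvalues t = i})
    (_ : t ∈ Finset.univ) => (card_trace_eq t.1).trans (by rw [t.2])
  rw [Finset.sum_add_distrib, ← Nat.card_sigma, Finset.sum_const, Finset.sum_const,
    Finset.card_univ, ← Nat.card_eq_fintype_card, smul_eq_mul, smul_eq_mul] at hsum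
  rw [← hsum, Nat.card_congr (Equiv.sigmaSubtypeFiberEquivSubtype (fun x : SL(2, F) => x.1.trace)
    fun _ => Iff.rfl)]

variable [CharP F 2]

theorem card_centralizer_add_numEigenvalues {x : SL(2, F)} (hx : x ≠ 1) :
    Nat.card (centralizer {x}) + numEigenvalues x.1.trace = Fintype.card F + 1 := by
  have hcenter : x ∉ center SL(2, F) := by rwa [center_specialLinearGroup_eq_bot, mem_bot]
  rw [card_centralizer_specialLinearGroup hcenter, card_norm_eq_one]

theorem exists_card_properCentralizer_add_eq (H : ProperCentralizer SL(2, F)) :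
    ∃ i ≤ 2, Nat.card H.1 + i = Fintype.card F + 1 := by
  obtain ⟨_, htop, x, rfl⟩ := H
  have hx : x ≠ 1 := by
    rintro rfl
    exact htop (centralizer_eq_top_iff_subset.2 (by simp))
  exact ⟨_, numEigenvalues_le_two _, card_centralizer_add_numEigenvalues hx⟩

theorem card_properCentralizer_mul_add {i : ℕ} (hi : i ≤ Fintype.card F) :
    Nat.card {H : ProperCentralizer SL(2, F) // Nat.card H.1 = Fintype.card F + 1 - i} *
        (Fintype.card F - i) + (if i = 1 then 1 else 0) =
      Nat.card {x : SL(2, F) // numEigenvalues x.1.trace = i} := by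
  have hone : numEigenvalues (1 : SL(2, F)).1.trace = 1 :=
    numEigenvalues_eq_one_iff.2 (by simp [CharTwo.two_eq_zero])
  have hdiff : {x : SL(2, F) | x ≠ 1 ∧ Nat.card (centralizer {x}) = Fintype.card F + 1 - i} =
      {x : SL(2, F) | numEigenvalues x.1.trace = i} \ {1} := by
    ext x
    rcases eq_or_ne x 1 with rfl | hx
    · simp
    · have hcard := card_centralizer_add_numEigenvalues hx
      have hiff : Nat.card (centralizer {x}) = Fintype.card F + 1 - i ↔
          numEigenvalues x.1.trace = i := by omega
      simp [hx, hiff]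
  rw [← Nat.add_sub_cancel_left (n := 1) (m := Fintype.card F - i), ← Nat.add_sub_assoc hi,
    add_comm 1, (isCommutativeTransitive_specialLinearGroup
      center_specialLinearGroup_eq_bot).card_properCentralizer_mul center_specialLinearGroup_eq_bot,
    ← Set.coe_ofPred, ← Set.coe_ofPred, hdiff, Nat.card_coe_set_eq, Nat.card_coe_set_eq]
  split_ifs with h
  · exact Set.ncard_sdiff_singleton_add_one (hone.trans h.symm)
  · rw [Set.sdiff_singleton_eq_self fun hmem => h (hmem.symm.trans hone), add_zero]

theorem card_properCentralizer_specialLinearGroup (hF : 2 < Fintype.card F) :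
    Nat.card {H : ProperCentralizer SL(2, F) // Nat.card H.1 = Fintype.card F} =
      Fintype.card F + 1 ∧
    2 * Nat.card {H : ProperCentralizer SL(2, F) // Nat.card H.1 = Fintype.card F - 1} =
      Fintype.card F * (Fintype.card F + 1) ∧
    2 * Nat.card {H : ProperCentralizer SL(2, F) // Nat.card H.1 = Fintype.card F + 1} =
      Fintype.card F * (Fintype.card F - 1) := by
  obtain ⟨hfiber₁, hfiber₂, hfiber₀⟩ := card_fiber_numEigenvalues (F := F)
  have h₀ := card_numEigenvalues_trace_eq (F := F) 0
  have h₁ := card_numEigenvalues_trace_eq (F := F) 1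
  have h₂ := card_numEigenvalues_trace_eq (F := F) 2
  rw [← card_properCentralizer_mul_add (by omega)] at h₀ h₁ h₂
  simp only [hfiber₁, Nat.sub_zero, Nat.add_sub_cancel, zero_ne_one, OfNat.ofNat_ne_one, if_false,
    if_true, add_zero, mul_zero, mul_one, one_mul, Nat.reduceSubDiff] at h₀ h₁ h₂
  generalize Fintype.card F = q at *
  generalize Nat.card {t : F // numEigenvalues t = 2} = b at *
  generalize Nat.card {t : F // numEigenvalues t = 0} = a at *
  obtain rfl : a = b + 1 := by omega
  obtain rfl : q = 2 * b + 2 := by omega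
  have hb : 0 < b := by omega
  simp only [Nat.add_sub_cancel, Nat.add_succ_sub_one] at h₀ h₁ h₂ ⊢
  refine ⟨Nat.eq_of_mul_eq_mul_right (Nat.succ_pos (2 * b)) ?_,
    Nat.eq_of_mul_eq_mul_right hb ?_, Nat.eq_of_mul_eq_mul_right (Nat.succ_pos b) ?_⟩ <;> linarith

theorem nonempty_coCentralizerGraph_specialLinearGroup_iso {p : ℕ} (hp : 2 ≤ p)
    (hF : Fintype.card F = 2 * p) :
    Nonempty (coCentralizerGraph SL(2, F) ≃g SimpleGraph.completeMultipartiteGraph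
      fun i : Fin 3 => Fin (![2 * p + 1, p * (2 * p + 1), p * (2 * p - 1)] i)) := by
  obtain ⟨hq, hqsub, hqadd⟩ := card_properCentralizer_specialLinearGroup (F := F) (by omega)
  rw [coCentralizerGraph_eq_comap]
  refine nonempty_comap_top_iso_completeMultipartiteGraph
    (c := ![2 * p, 2 * p - 1, 2 * p + 1]) ?_ (fun H => ?_) fun i => ?_
  · intro i j hij
    fin_cases i <;> fin_cases j <;> simp at hij ⊢ <;> omega
  · obtain ⟨i, hi, hH⟩ := exists_card_properCentralizer_add_eq H
    interval_cases i
    · exact ⟨2, by simp; omega⟩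
    · exact ⟨0, by simp; omega⟩
    · exact ⟨1, by simp; omega⟩
  · rw [hF] at hq hqsub hqadd
    fin_cases i
    · exact hq
    · exact Nat.eq_of_mul_eq_mul_left two_pos (hqsub.trans (mul_assoc ..))
    · exact Nat.eq_of_mul_eq_mul_left two_pos (hqadd.trans (mul_assoc ..))

end CharTwo

theorem nonempty_projectiveSpecialLinearGroup_mulEquiv {n R : Type*} [Fintype n] [DecidableEq n]
    [CommRing R] (h : Subgroup.center (Matrix.SpecialLinearGroup n R) = ⊥) :
    Nonempty (Matrix.ProjectiveSpecialLinearGroup n R ≃* Matrix.SpecialLinearGroup n R) :=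
  ⟨(QuotientGroup.quotientMulEquivOfEq h).trans QuotientGroup.quotientBot⟩

theorem nonempty_coCentralizerGraph_projectiveSpecialLinearGroup_iso {F : Type*} [Field F]
    [Fintype F] {k : ℕ} (hk : 2 ≤ k) (hF : Fintype.card F = 2 ^ k) :
    Nonempty (coCentralizerGraph (Matrix.ProjectiveSpecialLinearGroup (Fin 2) F) ≃g
      SimpleGraph.completeMultipartiteGraph fun i : Fin 3 =>
        Fin (![2 ^ k + 1, 2 ^ (k - 1) * (2 ^ k + 1), 2 ^ (k - 1) * (2 ^ k - 1)] i)) := by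
  have : Fact (Nat.Prime 2) := ⟨Nat.prime_two⟩
  have : CharP F 2 := charP_of_card_eq_prime_pow hF
  have hpow : 2 ^ k = 2 * 2 ^ (k - 1) := (mul_pow_sub_one (by omega) 2).symm
  have htwo : 2 ≤ 2 ^ (k - 1) := Nat.le_self_pow (by omega) 2
  obtain ⟨e⟩ := nonempty_projectiveSpecialLinearGroup_mulEquiv (n := Fin 2)
    (center_specialLinearGroup_eq_bot (R := F))
  obtain ⟨f⟩ := nonempty_coCentralizerGraph_iso e
  obtain ⟨g⟩ := nonempty_coCentralizerGraph_specialLinearGroup_iso htwo (hF.trans hpow)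
  rw [hpow]
  exact ⟨f.trans g⟩

theorem card_tripartite_pos {k : ℕ} (hk : k ≠ 0) (i : Fin 3) :
    0 < ![2 ^ k + 1, 2 ^ (k - 1) * (2 ^ k + 1), 2 ^ (k - 1) * (2 ^ k - 1)] i := by
  have hpow : 0 < 2 ^ k - 1 := Nat.sub_pos_of_lt (Nat.one_lt_two_pow hk)
  fin_cases i <;> simp [hpow]

theorem distLaplacianSpectrum_tripartite {k : ℕ} (hk : k ≠ 0) :
    (SimpleGraph.completeMultipartiteGraph fun i : Fin 3 => Fin (![2 ^ k + 1,
      2 ^ (k - 1) * (2 ^ k + 1), 2 ^ (k - 1) * (2 ^ k - 1)] i)).distLaplacianSpectrum =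
      Multiset.replicate 1 (0 : ℝ) +
      Multiset.replicate (2 ^ (k - 1) * (2 ^ k + 1) - 1)
        (3 * 2 ^ (2 * k - 1) + 3 * 2 ^ (k - 1) + 1 : ℝ) +
      Multiset.replicate (2 ^ (k - 1) * (2 ^ k - 1) - 1)
        (3 * 2 ^ (2 * k - 1) + 2 ^ (k - 1) + 1 : ℝ) +
      Multiset.replicate (2 ^ k) (2 ^ (2 * k) + 2 ^ (k + 1) + 2 : ℝ) +
      Multiset.replicate 2 (2 ^ (2 * k) + 2 ^ k + 1 : ℝ) := by
  have (i : Fin 3) := Fin.pos_iff_nonempty.1 (card_tripartite_pos hk i)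
  rw [distLaplacianSpectrum_completeMultipartiteGraph, Multiset.replicate_one]
  obtain ⟨m, rfl⟩ := Nat.exists_eq_add_one_of_ne_zero hk
  have hexp : 2 * (m + 1) - 1 = m * 2 + 1 := by omega
  have hcard : ((2 ^ (m + 1) + 1 + 2 ^ m * (2 ^ (m + 1) + 1) + 2 ^ m * (2 ^ (m + 1) - 1) : ℕ) : ℝ) =
      2 ^ (2 * (m + 1)) + 2 ^ (m + 1) + 1 := by
    push_cast [Nat.one_le_two_pow]
    ring
  have heig₀ : (2 ^ (2 * (m + 1)) + 2 ^ (m + 1) + 1 + (2 ^ (m + 1) + 1 : ℕ) : ℝ) =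
      2 ^ (2 * (m + 1)) + 2 ^ (m + 1 + 1) + 2 := by
    push_cast
    ring
  have heig₁ : (2 ^ (2 * (m + 1)) + 2 ^ (m + 1) + 1 + (2 ^ m * (2 ^ (m + 1) + 1) : ℕ) : ℝ) =
      3 * 2 ^ (m * 2 + 1) + 3 * 2 ^ m + 1 := by
    push_cast
    ring
  have heig₂ : (2 ^ (2 * (m + 1)) + 2 ^ (m + 1) + 1 + (2 ^ m * (2 ^ (m + 1) - 1) : ℕ) : ℝ) =
      3 * 2 ^ (m * 2 + 1) + 2 ^ m + 1 := by
    push_cast [Nat.one_le_two_pow]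
    ring
  simp only [Fintype.card_sigma, Fintype.card_fin, Fin.sum_univ_three, Matrix.cons_val, hexp,
    Nat.add_sub_cancel, hcard, heig₀, heig₁, heig₂]
  abel

theorem nodup_distLaplacian_eigenvalues_tripartite {k : ℕ} (hk : 2 ≤ k) :
    ([0, 3 * 2 ^ (2 * k - 1) + 3 * 2 ^ (k - 1) + 1, 3 * 2 ^ (2 * k - 1) + 2 ^ (k - 1) + 1,
      2 ^ (2 * k) + 2 ^ (k + 1) + 2, 2 ^ (2 * k) + 2 ^ k + 1] : List ℝ).Nodup := by
  obtain ⟨m, rfl⟩ : ∃ m, k = m + 1 := ⟨k - 1, by omega⟩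
  have hexp : 2 * (m + 1) - 1 = m * 2 + 1 := by omega
  have htwo : (2 : ℝ) ≤ 2 ^ m := le_self_pow₀ one_le_two (by omega)
  rw [hexp, Nat.add_sub_cancel, mul_comm 2 (m + 1), add_mul]
  simp only [pow_add, pow_mul]
  generalize (2 : ℝ) ^ m = a at htwo ⊢
  simp only [List.nodup_cons, List.mem_cons, List.not_mem_nil, or_false, not_or,
    not_false_eq_true, List.nodup_nil, and_true]
  refine ⟨⟨?_, ?_, ?_, ?_⟩, ⟨?_, ?_, ?_⟩, ⟨?_, ?_⟩, ?_⟩ <;> intro h <;> nlinarith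

theorem mainTheorem1 (k : ℕ) (hk : 2 ≤ k) (F : Type*) [Field F] [Fintype F]
    (hF : Fintype.card F = 2 ^ k) :
    Nonempty (coCentralizerGraph (Matrix.ProjectiveSpecialLinearGroup (Fin 2) F) ≃g
      SimpleGraph.completeMultipartiteGraph (fun i : Fin 3 =>
        Fin (![2 ^ k + 1, 2 ^ (k - 1) * (2 ^ k + 1), 2 ^ (k - 1) * (2 ^ k - 1)] i))) ∧
    (coCentralizerGraph (Matrix.ProjectiveSpecialLinearGroup (Fin 2) F)).distLaplacianSpectrum =
      Multiset.replicate 1 (0 : ℝ) +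
      Multiset.replicate (2 ^ (k - 1) * (2 ^ k + 1) - 1)
        (3 * 2 ^ (2 * k - 1) + 3 * 2 ^ (k - 1) + 1 : ℝ) +
      Multiset.replicate (2 ^ (k - 1) * (2 ^ k - 1) - 1)
        (3 * 2 ^ (2 * k - 1) + 2 ^ (k - 1) + 1 : ℝ) +
      Multiset.replicate (2 ^ k) (2 ^ (2 * k) + 2 ^ (k + 1) + 2 : ℝ) +
      Multiset.replicate 2 (2 ^ (2 * k) + 2 ^ k + 1 : ℝ) ∧
    ([0, 3 * 2 ^ (2 * k - 1) + 3 * 2 ^ (k - 1) + 1, 3 * 2 ^ (2 * k - 1) + 2 ^ (k - 1) + 1,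
      2 ^ (2 * k) + 2 ^ (k + 1) + 2, 2 ^ (2 * k) + 2 ^ k + 1] : List ℝ).Nodup ∧
    (coCentralizerGraph
      (Matrix.ProjectiveSpecialLinearGroup (Fin 2) F)).IsDistLaplacianIntegral := by
  have (i : Fin 3) := Fin.pos_iff_nonempty.1 (card_tripartite_pos (by omega : k ≠ 0) i)
  obtain ⟨e⟩ := nonempty_coCentralizerGraph_projectiveSpecialLinearGroup_iso hk hF
  have hspec := distLaplacianSpectrum_eq_of_iso e
  refine ⟨⟨e⟩, hspec.trans (distLaplacianSpectrum_tripartite (by omega)),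
    nodup_distLaplacian_eigenvalues_tripartite hk, ?_⟩
  rw [SimpleGraph.IsDistLaplacianIntegral, hspec]
  exact isDistLaplacianIntegral_completeMultipartiteGraph
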